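/- Let $(\Omega,\mathcal A,\mathbb P)$ be a probability space, let $D\subseteq\mathbb R^d$ be compact, and let $g:\Omega\times D\to\mathbb R^d$ be a Gaussian process, i.e. for all $x_1,\dots,x_N\in D$ the random vectors $g(\cdot,x_1),\dots,g(\cdot,x_N)$ are jointly normal (possibly degenerate). Let $$m(x)=\mathbb E[g(\cdot,x)],\qquad K(x,x')=\mathbb E\big[(g(\cdot,x)-m(x))(g(\cdot,x')-m(x'))^{\mathrm T}\big]$$ be its mean and its matrix-valued covariance kernel. A field $v:D\to\mathbb R^d$ is continuously differentiable on $D$ if there is a continuous map $J:D\to\mathbb R^{d\times d}$ such that, for every $x\in D$, $v(y)=v(x)+J(x)(y-x)+o(|y-x|)$ as $y\to x$ in $D$. Let $D^*$ be the set of all points of $D$ that are limits of points $x\in D$ at which the tangent cone of $D$ spans $\mathbb R^d$; on $D^*$ the Jacobian $J$ is uniquely determined by $v$, and $D^*=D$ if, for instance, $D$ is the closure of an open set. A field $v$ is called divergence-free if it is continuously differentiable on $D$ and $\operatorname{div}v=\sum_k\partial v_k/\partial x_k=\operatorname{tr}J$ vanishes on $D^*$. For $d=2,3$ it is called curl-free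 if it is continuously differentiable on $D$ and $\operatorname{curl}v$ vanishes on $D^*$, where $\operatorname{curl}v=\partial_1v_2-\partial_2v_1$ for $d=2$ and $\operatorname{curl}v=(\partial_2v_3-\partial_3v_2,\ \partial_3v_1-\partial_1v_3,\ \partial_1v_2-\partial_2v_1)^{\mathrm T}$ for $d=3$. Theorem. Suppose that $g(\omega,\cdot)$ is continuously differentiable on $D$ for $\mathbb P$-almost every $\omega$. 1. If $m$ is divergence-free and, for every $x'\in D$, each column of $K(\cdot,x')$ is divergence-free, then for $\mathbb P$-almost every $\omega$ the field $g(\omega,\cdot)$ is divergence-free. 2. Let $d\in\{2,3\}$. If $m$ is curl-free and, for every $x'\in D$, each column of $K(\cdot,x')$ is curl-free, then for $\mathbb P$-almost every $\omega$ the field $g(\omega,\cdot)$ is curl-free. -/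

import Mathlib

open MeasureTheory ProbabilityTheory
open scoped BigOperators

noncomputable section

/-- Euclidean space `ℝ^d`. -/
abbrev Vec (d : ℕ) : Type := EuclideanSpace ℝ (Fin d)

/-! ### Divergence and curl in terms of the Jacobian -/

/-- The partial derivative `∂ v_k / ∂ x_j` read off from the Jacobian `A` of `v` at a point. -/
def partialOf {d : ℕ} (A : Vec d →L[ℝ] Vec d) (k j : Fin d) : ℝ :=
  A (EuclideanSpace.single j 1) k

/-- `div v = ∑ k, ∂ v_k / ∂ x_k`. -/
def divOf {d : ℕ} (A : Vec d →L[ℝ] Vec d) : ℝ :=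
  ∑ k : Fin d, partialOf A k k

/-- The scalar curl in the plane, `∂ v₂ / ∂ x₁ - ∂ v₁ / ∂ x₂` (coordinates are indexed from 0). -/
def curlOf2 (A : Vec 2 →L[ℝ] Vec 2) : ℝ :=
  partialOf A 1 0 - partialOf A 0 1

/-- The curl in space,
`(∂ v₃/∂ x₂ - ∂ v₂/∂ x₃, ∂ v₁/∂ x₃ - ∂ v₃/∂ x₁, ∂ v₂/∂ x₁ - ∂ v₁/∂ x₂)`
(coordinates are indexed from 0). -/
def curlOf3 (A : Vec 3 →L[ℝ] Vec 3) : Vec 3 :=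
  !₂[partialOf A 2 1 - partialOf A 1 2,
     partialOf A 0 2 - partialOf A 2 0,
     partialOf A 1 0 - partialOf A 0 1]

/-! ### Continuously differentiable vector fields on a set, divergence-free and curl-free -/

/-- `J` is a continuous Jacobian field of `v` on `D` (derivatives at points of `D` are taken
relative to `D`, so one-sided at the boundary). Only the values of `v` on `D` matter. -/
structure HasC1DerivOn {d : ℕ} (D : Set (Vec d)) (v : Vec d → Vec d)
    (J : Vec d → Vec d →L[ℝ] Vec d) : Prop where
  continuousOn : ContinuousOn J D
  hasFDerivWithinAt : ∀ x ∈ D, HasFDerivWithinAt v (J x) D x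

/-- `v` is continuously differentiable on `D`. -/
def IsC1On {d : ℕ} (D : Set (Vec d)) (v : Vec d → Vec d) : Prop :=
  ∃ J, HasC1DerivOn D v J

/-- The points of `D` at which the Jacobian of a `C¹` field on `D` is determined by its values
on `D`: the points where derivatives relative to `D` are unique, and their limits in `D` (there
the Jacobian is determined by continuity). If `D` is contained in the closure of its interior,
this is all of `D`, see `jacobianPoints_eq_self`. A set such as a line segment in the plane has
no such points, and partial derivatives of fields on it have no meaning. -/
def jacobianPoints {d : ℕ} (D : Set (Vec d)) : Set (Vec d) :=
  D ∩ closure {x ∈ D | UniqueDiffWithinAt ℝ D x}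

theorem jacobianPoints_eq_self {d : ℕ} {D : Set (Vec d)} (hD : D ⊆ closure (interior D)) :
    jacobianPoints D = D := by
  refine Set.inter_eq_left.2 (hD.trans (closure_mono fun x hx => ⟨interior_subset hx, ?_⟩))
  exact uniqueDiffWithinAt_of_mem_nhds (mem_interior_iff_mem_nhds.1 hx)

/-- At the points of `jacobianPoints D` all continuous Jacobian fields of `v` agree. -/
theorem HasC1DerivOn.eqOn {d : ℕ} {D : Set (Vec d)} {v : Vec d → Vec d}
    {J J' : Vec d → Vec d →L[ℝ] Vec d} (h : HasC1DerivOn D v J) (h' : HasC1DerivOn D v J') :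
    Set.EqOn J J' (jacobianPoints D) := by
  have h1 : Set.EqOn J J' {x ∈ D | UniqueDiffWithinAt ℝ D x} := fun x hx =>
    hx.2.eq (h.hasFDerivWithinAt x hx.1) (h'.hasFDerivWithinAt x hx.1)
  refine h1.of_subset_closure (h.continuousOn.mono Set.inter_subset_left)
    (h'.continuousOn.mono Set.inter_subset_left) ?_ Set.inter_subset_right
  exact fun x hx => ⟨hx.1, subset_closure hx⟩

/-- `v` is continuously differentiable on `D` and `div v = 0` on `D`. -/
def IsDivFreeOn {d : ℕ} (D : Set (Vec d)) (v : Vec d → Vec d) : Prop :=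
  IsC1On D v ∧ ∀ J, HasC1DerivOn D v J → ∀ x ∈ jacobianPoints D, divOf (J x) = 0

/-- `v` is continuously differentiable on `D ⊆ ℝ²` and `curl v = 0` on `D`. -/
def IsCurlFreeOn2 (D : Set (Vec 2)) (v : Vec 2 → Vec 2) : Prop :=
  IsC1On D v ∧ ∀ J, HasC1DerivOn D v J → ∀ x ∈ jacobianPoints D, curlOf2 (J x) = 0

/-- `v` is continuously differentiable on `D ⊆ ℝ³` and `curl v = 0` on `D`. -/
def IsCurlFreeOn3 (D : Set (Vec 3)) (v : Vec 3 → Vec 3) : Prop :=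
  IsC1On D v ∧ ∀ J, HasC1DerivOn D v J → ∀ x ∈ jacobianPoints D, curlOf3 (J x) = 0

/-! ### Vector-valued Gaussian processes -/

/-- `g : Ω × D → ℝ^d` is a Gaussian process: all its finite families are jointly normal (possibly
degenerate). Only the values of `g` at points of `D` matter. -/
def IsGaussianProcessOn {d : ℕ} {Ω : Type*} [MeasurableSpace Ω] (P : Measure Ω)
    (D : Set (Vec d)) (g : Ω → Vec d → Vec d) : Prop :=
  IsGaussianProcess (fun (x : D) (ω : Ω) => g ω x) P

/-- The mean `m(x) = 𝔼[g(·, x)]`. -/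
def meanField {d : ℕ} {Ω : Type*} [MeasurableSpace Ω] (P : Measure Ω)
    (g : Ω → Vec d → Vec d) (x : Vec d) : Vec d :=
  ∫ ω, g ω x ∂P

/-- The covariance kernel `K(x, x') = 𝔼[(g(·, x) - m(x)) (g(·, x') - m(x'))ᵀ]`. -/
def covKernel {d : ℕ} {Ω : Type*} [MeasurableSpace Ω] (P : Measure Ω)
    (g : Ω → Vec d → Vec d) (x x' : Vec d) : Matrix (Fin d) (Fin d) ℝ :=
  Matrix.of fun k l =>
    ∫ ω, (g ω x k - meanField P g x k) * (g ω x' l - meanField P g x' l) ∂P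

/-- The `l`-th column of `K(·, x')`, as a vector field. -/
def covColumn {d : ℕ} {Ω : Type*} [MeasurableSpace Ω] (P : Measure Ω)
    (g : Ω → Vec d → Vec d) (x' : Vec d) (l : Fin d) (x : Vec d) : Vec d :=
  WithLp.toLp 2 fun k => covKernel P g x x' k l

end

open Filter Topology

/-! Divergence and the curl components are linear functionals `T` of the Jacobian. Where the tangent
cone spans, `T` applied to the Jacobian is a limit of finite combinations of values on `D`, with
coefficients independent of the field. The same combinations thus act on the paths, on `m` and on
the columns of `K`. On paths they give Gaussian variables `Z n` converging a.s. to some `Y`, with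
means and covariances against each fixed `Z m` tending to zero. So `Y` is asymptotically
uncorrelated with every `Z m`, hence with itself, and vanishes
(`ae_eq_zero_of_gaussian_of_tendsto_covariance`). A countable dense set of points and continuity of
`J` give one null set for all of `jacobianPoints D`. -/

/-! ### Almost sure limits of Gaussian variables -/

/-- Almost sure convergence implies pointwise convergence of characteristic functions. -/
theorem tendsto_charFun_map_of_ae_tendsto {Ω : Type*} [MeasurableSpace Ω] {P : Measure Ω}
    [IsFiniteMeasure P] {Z : ℕ → Ω → ℝ} {Y : Ω → ℝ} (hZ : ∀ n, AEMeasurable (Z n) P)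
    (h : ∀ᵐ ω ∂P, Tendsto (fun n => Z n ω) atTop (𝓝 (Y ω))) (t : ℝ) :
    Tendsto (fun n => charFun (P.map (Z n)) t) atTop (𝓝 (charFun (P.map Y) t)) := by
  have hY : AEMeasurable Y P := aemeasurable_of_tendsto_metrizable_ae atTop hZ h
  have key : ∀ W : Ω → ℝ, AEMeasurable W P →
      charFun (P.map W) t = ∫ ω, Complex.exp (t * W ω * Complex.I) ∂P := fun W hW => by
    rw [charFun_apply_real, integral_map hW (by fun_prop)]
  rw [key Y hY]
  simp_rw [fun n => key (Z n) (hZ n)]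
  refine tendsto_integral_of_dominated_convergence (fun _ => 1) (fun n => ?_)
    (integrable_const 1) (fun n => ae_of_all _ fun ω => ?_) ?_
  · have := hZ n
    exact (by fun_prop : AEMeasurable (fun ω => Complex.exp (t * Z n ω * Complex.I)) P)
      |>.aestronglyMeasurable
  · rw [← Complex.ofReal_mul, Complex.norm_exp_ofReal_mul_I]
  · filter_upwards [h] with ω hω
    have hc : Continuous fun y : ℝ => Complex.exp (t * y * Complex.I) := by fun_prop
    exact (hc.tendsto _).comp hω

theorem ProbabilityTheory.HasGaussianLaw.charFun_map_real {Ω : Type*} [MeasurableSpace Ω]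
    {P : Measure Ω} {Z : Ω → ℝ} (hZ : HasGaussianLaw Z P) (t : ℝ) :
    charFun (P.map Z) t = Complex.exp (t * (P[Z] : ℝ) * Complex.I - (Var[Z; P] : ℝ) * t ^ 2 / 2) := by
  rw [hZ.map_eq_gaussianReal, charFun_gaussianReal, Real.coe_toNNReal _ (variance_nonneg _ _)]

/-- Let Gaussian variables `Z n` with Gaussian differences converge almost surely. If the means
tend to zero and so do the covariances of `Z n` with every fixed `Z m`, then the limit is zero. -/
theorem ae_eq_zero_of_gaussian_of_tendsto_covariance {Ω : Type*} [MeasurableSpace Ω]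
    {P : Measure Ω} [IsProbabilityMeasure P] {Z : ℕ → Ω → ℝ} {Y : Ω → ℝ}
    (hZ : ∀ n, HasGaussianLaw (Z n) P) (hsub : ∀ n m, HasGaussianLaw (Z n - Z m) P)
    (hmean : Tendsto (fun n => P[Z n]) atTop (𝓝 0))
    (hcov : ∀ m, Tendsto (fun n => cov[Z n, Z m; P]) atTop (𝓝 0))
    (h : ∀ᵐ ω ∂P, Tendsto (fun n => Z n ω) atTop (𝓝 (Y ω))) : Y =ᵐ[P] 0 := by
  have hZm : ∀ n, AEMeasurable (Z n) P := fun n => (hZ n).aemeasurable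
  have hY : AEMeasurable Y P := aemeasurable_of_tendsto_metrizable_ae atTop hZm h
  have := Measure.isProbabilityMeasure_map hY
  suffices hφ : ∀ t, charFun (P.map Y) t = 1 by
    have hmap : P.map Y = Measure.dirac 0 := Measure.ext_of_charFun <| by
      ext t
      simp [hφ t, charFun_dirac]
    have h0 : ∀ᵐ y ∂(P.map Y), y = 0 := by simp [hmap]
    exact ae_of_ae_map hY h0
  intro t
  set φ := charFun (P.map Y) t
  set r : ℕ → ℝ := fun n => Real.exp (-(Var[Z n; P] * t ^ 2 / 2)) with hr
  -- Multiplying by `exp(-i t 𝔼[Z n])`, which tends to 1, removes the phase.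
  have hrφ : Tendsto (fun n => (r n : ℂ)) atTop (𝓝 φ) := by
    have h1 := tendsto_charFun_map_of_ae_tendsto hZm h t
    have hc : Continuous fun a : ℝ => Complex.exp (-(t * a * Complex.I)) := by fun_prop
    have h2 := h1.mul ((hc.tendsto 0).comp hmean)
    simp only [Complex.ofReal_zero, mul_zero, zero_mul, neg_zero, Complex.exp_zero, mul_one] at h2
    refine h2.congr fun n => ?_
    rw [Function.comp_apply, (hZ n).charFun_map_real, ← Complex.exp_add, hr, Complex.ofReal_exp]
    push_cast
    ring_nf
  -- Fix `m` and let `n → ∞`: the cross term in `Var[Z n - Z m]` contributes `exp(t² cov[Z n, Z m])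
  -- → 1`, so the limit factors.
  have hφm : ∀ m, charFun (P.map (Y - Z m)) t
      = φ * (r m * Complex.exp (-(t * (P[Z m] : ℝ) * Complex.I))) := fun m => by
    refine tendsto_nhds_unique (tendsto_charFun_map_of_ae_tendsto (Z := fun n => Z n - Z m)
      (fun n => (hZm n).sub (hZm m)) ?_ t) ?_
    · filter_upwards [h] with ω hω
      exact hω.sub_const _
    · have hc : Continuous fun a : ℝ => Complex.exp (t * a * Complex.I) := by fun_prop
      have hc' : Continuous fun a : ℝ => Complex.exp (t ^ 2 * a) := by fun_prop
      have h2 := ((hrφ.mul_const (r m * Complex.exp (-(t * (P[Z m] : ℝ) * Complex.I)))).mul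
        ((hc.tendsto 0).comp hmean)).mul ((hc'.tendsto 0).comp (hcov m))
      simp only [Complex.ofReal_zero, mul_zero, zero_mul, Complex.exp_zero, mul_one] at h2
      refine h2.congr fun n => ?_
      rw [(hsub n m).charFun_map_real, variance_sub (hZ n).memLp_two (hZ m).memLp_two,
        integral_sub' (hZ n).integrable (hZ m).integrable]
      simp only [Function.comp_apply, hr, Complex.ofReal_exp, ← Complex.exp_add]
      push_cast
      ring_nf
  -- Now `m → ∞`: the factored form tends to `φ * φ`, while `Y - Z m → 0` a.s.
  have h1 : φ * φ = 1 := by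
    have hc : Continuous fun a : ℝ => Complex.exp (-(t * a * Complex.I)) := by fun_prop
    have h2 := (hrφ.mul ((hc.tendsto 0).comp hmean)).const_mul φ
    simp only [Complex.ofReal_zero, mul_zero, zero_mul, neg_zero, Complex.exp_zero, mul_one] at h2
    refine tendsto_nhds_unique h2 ?_
    have h3 := tendsto_charFun_map_of_ae_tendsto (P := P) (Z := fun m => Y - Z m) (Y := fun _ => 0)
      (fun m => hY.sub (hZm m)) (by
        filter_upwards [h] with ω hω
        simpa using hω.const_sub (Y ω)) t
    simp only [hφm] at h3
    simpa [charFun_dirac] using h3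
  -- As a limit of positive reals, `φ` cannot be `-1`.
  have hre : 0 ≤ φ.re := ge_of_tendsto'
    ((Complex.continuous_re.tendsto _).comp hrφ) fun n => (Real.exp_pos _).le
  rcases mul_self_eq_one_iff.1 h1 with h | h
  · exact h
  · rw [h] at hre
    norm_num at hre

/-- Let finite linear combinations of a real Gaussian process converge almost surely. If the same
combinations of the means and of every column of the covariance kernel tend to zero, then the
limit is zero. -/
theorem ProbabilityTheory.IsGaussianProcess.ae_eq_zero_of_tendsto_linearCombination
    {Ω ι : Type*} [MeasurableSpace Ω] {P : Measure Ω} [IsProbabilityMeasure P]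
    {C : ι → Ω → ℝ} (hC : IsGaussianProcess C P) {Y : Ω → ℝ} (c : ℕ → ι →₀ ℝ)
    (hmean : Tendsto (fun n => Finsupp.linearCombination ℝ (fun q => P[C q]) (c n)) atTop (𝓝 0))
    (hcov : ∀ s, Tendsto (fun n => Finsupp.linearCombination ℝ (fun q => cov[C q, C s; P]) (c n))
      atTop (𝓝 0))
    (h : ∀ᵐ ω ∂P, Tendsto (fun n => Finsupp.linearCombination ℝ (fun q => C q ω) (c n)) atTop
      (𝓝 (Y ω))) : Y =ᵐ[P] 0 := by
  -- Indexing by all finite combinations makes each `Z n` and each difference Gaussian at once.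
  have hG : IsGaussianProcess
      (fun (a : ι →₀ ℝ) ω => Finsupp.linearCombination ℝ (fun q => C q ω) a) P :=
    hC.of_isGaussianProcess fun a => ⟨a.support,
      ∑ q : a.support, a q • ContinuousLinearMap.proj (R := ℝ) (φ := fun _ => ℝ) q, fun ω => by
        simp [Finsupp.linearCombination_apply, Finsupp.sum, ← Finset.sum_coe_sort a.support]⟩
  have hL : ∀ q, MemLp (C q) 2 P := fun q => (hC.hasGaussianLaw_eval q).memLp_two
  have hsum : ∀ a : ι →₀ ℝ, (fun ω => Finsupp.linearCombination ℝ (fun q => C q ω) a)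
      = ∑ q ∈ a.support, a q • C q := fun a => by
    ext ω
    simp [Finsupp.linearCombination_apply, Finsupp.sum]
  refine ae_eq_zero_of_gaussian_of_tendsto_covariance
    (fun n => hG.hasGaussianLaw_eval (c n)) (fun n m => hG.hasGaussianLaw_sub) ?_ ?_ h
  · refine hmean.congr fun n => ?_
    simp only [Finsupp.linearCombination_apply, Finsupp.sum, smul_eq_mul]
    rw [integral_finsetSum _ fun q _ => ((hL q).integrable (by norm_num)).const_mul _]
    simp_rw [integral_const_mul]
  · intro m
    have h0 : Tendsto (fun n => ∑ s ∈ (c m).support, c m s *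
        Finsupp.linearCombination ℝ (fun q => cov[C q, C s; P]) (c n)) atTop (𝓝 0) := by
      simpa using tendsto_finsetSum (c m).support fun s _ => (hcov s).const_mul (c m s)
    refine h0.congr fun n => ?_
    rw [hsum, hsum, covariance_sum_sum' (fun q _ => (hL q).const_smul _)
      (fun q _ => (hL q).const_smul _), Finset.sum_comm]
    simp only [Finsupp.linearCombination_apply, Finsupp.sum, smul_eq_mul, Finset.mul_sum,
      covariance_smul_left, covariance_smul_right]

/-! ### Jacobian functionals as limits of finite combinations -/

/-- Every directional derivative along the tangent cone of `D` is a limit of linear combinations of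
values on `D`, with coefficients that do not depend on the field. -/
theorem exists_tendsto_linearCombination_of_mem_tangentConeAt {d : ℕ} {D : Set (Vec d)}
    {x w : Vec d} (hx : x ∈ D) (hw : w ∈ tangentConeAt ℝ D x) (k : Fin d) :
    ∃ c : ℕ → (D × Fin d →₀ ℝ), ∀ (v : Vec d → Vec d) (A : Vec d →L[ℝ] Vec d),
        HasFDerivWithinAt v A D x →
      Tendsto (fun n => Finsupp.linearCombination ℝ (fun q : D × Fin d => v q.1 q.2) (c n)) atTop
        (𝓝 (A w k)) := by
  obtain ⟨α, l, hl, a, e, he, hD, hae⟩ := exists_fun_of_mem_tangentConeAt hw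
  -- The tangent cone supplies a general filter; the probabilistic limits need a sequence.
  have hex : ∀ n : ℕ, ∃ i, dist (e i) 0 < 1 / ((n : ℝ) + 1) ∧ x + e i ∈ D ∧
      dist (a i • e i) w < 1 / ((n : ℝ) + 1) := fun n =>
    ((Metric.tendsto_nhds.1 he _ Nat.one_div_pos_of_nat).and
      (hD.and (Metric.tendsto_nhds.1 hae _ Nat.one_div_pos_of_nat))).exists
  choose i hi0 hiD hiw using hex
  have squeeze : ∀ {u : ℕ → Vec d} {y : Vec d}, (∀ n : ℕ, dist (u n) y < 1 / ((n : ℝ) + 1)) →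
      Tendsto u atTop (𝓝 y) := fun h => tendsto_iff_dist_tendsto_zero.2 <|
    squeeze_zero (fun _ => dist_nonneg) (fun n => (h n).le) tendsto_one_div_add_atTop_nhds_zero_nat
  refine ⟨fun n => a (i n) • (Finsupp.single (⟨x + e (i n), hiD n⟩, k) 1
    - Finsupp.single (⟨x, hx⟩, k) 1), fun v A hA => ?_⟩
  have hlim := hA.lim (squeeze hi0) (Eventually.of_forall hiD) (squeeze hiw)
  have hk := ((EuclideanSpace.proj (𝕜 := ℝ) k).continuous.tendsto _).comp hlim
  simpa [Function.comp_def] using hk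

/-- At a point where derivatives relative to `D` are unique, every linear functional of the
Jacobian is a limit of linear combinations of values on `D`. -/
theorem exists_tendsto_linearCombination_of_uniqueDiffWithinAt {d : ℕ} {D : Set (Vec d)}
    {x : Vec d} (hx : x ∈ D) (hu : UniqueDiffWithinAt ℝ D x) (T : (Vec d →L[ℝ] Vec d) →ₗ[ℝ] ℝ) :
    ∃ c : ℕ → (D × Fin d →₀ ℝ), ∀ (v : Vec d → Vec d) (A : Vec d →L[ℝ] Vec d),
        HasFDerivWithinAt v A D x →
      Tendsto (fun n => Finsupp.linearCombination ℝ (fun q : D × Fin d => v q.1 q.2) (c n)) atTop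
        (𝓝 (T A)) := by
  -- The representable functionals form a subspace, so directions in the tangent cone suffice.
  let S : Submodule ℝ ((Vec d →L[ℝ] Vec d) → ℝ) :=
    { carrier := {F | ∃ c : ℕ → (D × Fin d →₀ ℝ), ∀ (v : Vec d → Vec d) (A : Vec d →L[ℝ] Vec d),
        HasFDerivWithinAt v A D x →
        Tendsto (fun n => Finsupp.linearCombination ℝ (fun q : D × Fin d => v q.1 q.2) (c n)) atTop
          (𝓝 (F A))}
      zero_mem' := ⟨0, fun v A _ => by simp⟩
      add_mem' := by
        rintro F G ⟨c, hc⟩ ⟨c', hc'⟩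
        exact ⟨c + c', fun v A hA => by simpa using (hc v A hA).add (hc' v A hA)⟩
      smul_mem' := by
        rintro r F ⟨c, hc⟩
        exact ⟨r • c, fun v A hA => by simpa using (hc v A hA).const_mul r⟩ }
  -- A dense subspace in finite dimension is everything.
  have hspan : Submodule.span ℝ (tangentConeAt ℝ D x) = ⊤ := by
    rw [← Submodule.dense_iff_topologicalClosure_eq_top.1 hu.dense_tangentConeAt,
      (Submodule.closed_of_finiteDimensional _).submodule_topologicalClosure_eq]
  have happly : ∀ w (k : Fin d), (fun A : Vec d →L[ℝ] Vec d => A w k) ∈ S := fun w k => by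
    have hw : w ∈ Submodule.span ℝ (tangentConeAt ℝ D x) := hspan ▸ Submodule.mem_top
    induction hw using Submodule.span_induction with
    | mem w hw => exact exists_tendsto_linearCombination_of_mem_tangentConeAt hx hw k
    | zero =>
      convert S.zero_mem using 1
      ext; simp
    | add u w _ _ hu hw =>
      convert S.add_mem hu hw using 1
      ext; simp
    | smul r w _ hw =>
      convert S.smul_mem r hw using 1
      ext; simp
  have hT : (T : (Vec d →L[ℝ] Vec d) → ℝ) = ∑ j : Fin d, ∑ k : Fin d,
      T ((EuclideanSpace.proj (𝕜 := ℝ) j).smulRight (EuclideanSpace.single k 1 : Vec d)) •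
        fun A : Vec d →L[ℝ] Vec d => A (EuclideanSpace.single j 1) k := by
    ext A
    have hA : A = ∑ j : Fin d, ∑ k : Fin d, A (EuclideanSpace.single j 1) k •
        (EuclideanSpace.proj (𝕜 := ℝ) j).smulRight (EuclideanSpace.single k 1 : Vec d) := by
      ext v i
      have hv : v = ∑ j : Fin d, v j • (EuclideanSpace.single j 1 : Vec d) := by
        ext i
        simp [Pi.single_apply]
      conv_lhs => rw [hv]
      simp [Pi.single_apply, mul_comm]
    conv_lhs => rw [hA]
    simp [mul_comm]
  have hTS : (T : (Vec d →L[ℝ] Vec d) → ℝ) ∈ S := hT ▸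
    S.sum_mem fun j _ => S.sum_mem fun k _ => S.smul_mem _ (happly _ k)
  exact hTS

/-! ### From single points to `jacobianPoints D` -/

theorem ae_forall_eq_zero_of_uniqueDiffWithinAt {Ω : Type*} [MeasurableSpace Ω] {P : Measure Ω}
    [IsProbabilityMeasure P] {d : ℕ} {D : Set (Vec d)} {g : Ω → Vec d → Vec d}
    (hg : IsGaussianProcessOn P D g) (hC1 : ∀ᵐ ω ∂P, IsC1On D (g ω))
    (T : (Vec d →L[ℝ] Vec d) →ₗ[ℝ] ℝ) {x : Vec d} (hx : x ∈ D) (hu : UniqueDiffWithinAt ℝ D x)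
    (hm : ∃ A, HasFDerivWithinAt (meanField P g) A D x ∧ T A = 0)
    (hK : ∀ x' ∈ D, ∀ l, ∃ A, HasFDerivWithinAt (covColumn P g x' l) A D x ∧ T A = 0) :
    ∀ᵐ ω ∂P, ∀ A, HasFDerivWithinAt (g ω) A D x → T A = 0 := by
  obtain ⟨c, hc⟩ := exists_tendsto_linearCombination_of_uniqueDiffWithinAt hx hu T
  have hC : IsGaussianProcess (fun (q : D × Fin d) ω => g ω q.1 q.2) P :=
    (hg.comp_right Prod.fst).comp_left fun q => EuclideanSpace.proj q.2
  have hmean : ∀ (y : D) k, ∫ ω, g ω y k ∂P = meanField P g y k := fun y k =>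
    (EuclideanSpace.proj (𝕜 := ℝ) k).integral_comp_comm (hg.hasGaussianLaw_eval y).integrable
  -- `fderivWithin` fixes one limit per path; uniqueness of the derivative then covers every `A`.
  have hY : (fun ω => T (fderivWithin ℝ (g ω) D x)) =ᵐ[P] 0 := by
    refine hC.ae_eq_zero_of_tendsto_linearCombination c ?_ (fun s => ?_) ?_
    · obtain ⟨A, hA, hTA⟩ := hm
      simpa only [hmean, hTA] using hc _ _ hA
    · obtain ⟨A, hA, hTA⟩ := hK s.1 s.1.2 s.2
      have h := hc _ _ hA
      simpa only [covColumn, covKernel, covariance, hmean, hTA, Matrix.of_apply] using h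
    · filter_upwards [hC1] with ω ⟨J, hJ⟩
      exact hc _ _ (hJ.hasFDerivWithinAt x hx).differentiableWithinAt.hasFDerivWithinAt
  filter_upwards [hY] with ω hω A hA
  rw [← hA.fderivWithin hu]
  exact hω

/-- If a continuous linear relation holds for the Jacobians of the mean and of the columns of the
covariance kernel, it holds almost surely for the Jacobian of the paths. -/
theorem ae_forall_jacobian_eq_zero {Ω : Type*} [MeasurableSpace Ω] {P : Measure Ω}
    [IsProbabilityMeasure P] {d : ℕ} {D : Set (Vec d)} {g : Ω → Vec d → Vec d}
    (hg : IsGaussianProcessOn P D g) (hC1 : ∀ᵐ ω ∂P, IsC1On D (g ω))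
    (T : (Vec d →L[ℝ] Vec d) →ₗ[ℝ] ℝ)
    (hm : IsC1On D (meanField P g) ∧
      ∀ J, HasC1DerivOn D (meanField P g) J → ∀ x ∈ jacobianPoints D, T (J x) = 0)
    (hK : ∀ x' ∈ D, ∀ l, IsC1On D (covColumn P g x' l) ∧
      ∀ J, HasC1DerivOn D (covColumn P g x' l) J → ∀ x ∈ jacobianPoints D, T (J x) = 0) :
    ∀ᵐ ω ∂P, ∀ J, HasC1DerivOn D (g ω) J → ∀ x ∈ jacobianPoints D, T (J x) = 0 := by
  -- Countability of `S` lets the null sets of its points be united.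
  obtain ⟨S, hSU, hS, hUS⟩ := (TopologicalSpace.IsSeparable.of_separableSpace
    {x ∈ D | UniqueDiffWithinAt ℝ D x}).exists_countable_dense_subset
  have hJac : ∀ x ∈ S, x ∈ jacobianPoints D := fun x hx =>
    ⟨(hSU hx).1, subset_closure (hSU hx)⟩
  have hae : ∀ᵐ ω ∂P, ∀ x ∈ S, ∀ A, HasFDerivWithinAt (g ω) A D x → T A = 0 := by
    refine (ae_ball_iff hS).2 fun x hx =>
      ae_forall_eq_zero_of_uniqueDiffWithinAt hg hC1 T (hSU hx).1 (hSU hx).2 ?_ fun x' hx' l => ?_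
    · obtain ⟨⟨J, hJ⟩, h⟩ := hm
      exact ⟨J x, hJ.hasFDerivWithinAt x (hSU hx).1, h J hJ x (hJac x hx)⟩
    · obtain ⟨⟨J, hJ⟩, h⟩ := hK x' hx' l
      exact ⟨J x, hJ.hasFDerivWithinAt x (hSU hx).1, h J hJ x (hJac x hx)⟩
  filter_upwards [hae] with ω hω J hJ
  have hT : Continuous T := T.continuous_of_finiteDimensional
  have hz : Set.EqOn (fun x => T (J x)) 0 S := fun x hx =>
    hω x hx (J x) (hJ.hasFDerivWithinAt x (hSU hx).1)
  exact hz.of_subset_closure (hT.comp_continuousOn (hJ.continuousOn.mono Set.inter_subset_left))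
    continuousOn_const hJac fun x hx => closure_minimal hUS isClosed_closure hx.2

/-! ### Divergence and curl -/

/-- The partial derivative `∂ v_k / ∂ x_j` as a linear functional of the Jacobian. -/
noncomputable def partialOfLinear {d : ℕ} (k j : Fin d) : (Vec d →L[ℝ] Vec d) →ₗ[ℝ] ℝ where
  toFun A := partialOf A k j
  map_add' A B := by simp [partialOf]
  map_smul' r A := by simp [partialOf]

theorem partialOfLinear_apply {d : ℕ} (k j : Fin d) (A : Vec d →L[ℝ] Vec d) :
    partialOfLinear k j A = partialOf A k j := rfl

theorem curlOf3_eq_zero_iff (A : Vec 3 →L[ℝ] Vec 3) :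
    curlOf3 A = 0 ↔ partialOf A 2 1 - partialOf A 1 2 = 0 ∧
      partialOf A 0 2 - partialOf A 2 0 = 0 ∧ partialOf A 1 0 - partialOf A 0 1 = 0 := by
  constructor
  · intro h
    exact ⟨congrArg (fun v : Vec 3 => v 0) h, congrArg (fun v : Vec 3 => v 1) h,
      congrArg (fun v : Vec 3 => v 2) h⟩
  · rintro ⟨h0, h1, h2⟩
    ext i
    fin_cases i <;> simp [curlOf3, h0, h1, h2]

theorem mainTheorem4 {Ω : Type*} [MeasurableSpace Ω] (P : Measure Ω) [IsProbabilityMeasure P] :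
    (∀ (d : ℕ) (D : Set (Vec d)) (g : Ω → Vec d → Vec d), IsCompact D →
      IsGaussianProcessOn P D g → (∀ᵐ ω ∂P, IsC1On D (g ω)) →
      IsDivFreeOn D (meanField P g) →
      (∀ x' ∈ D, ∀ l : Fin d, IsDivFreeOn D (covColumn P g x' l)) →
      ∀ᵐ ω ∂P, IsDivFreeOn D (g ω)) ∧
    (∀ (D : Set (Vec 2)) (g : Ω → Vec 2 → Vec 2), IsCompact D →
      IsGaussianProcessOn P D g → (∀ᵐ ω ∂P, IsC1On D (g ω)) →
      IsCurlFreeOn2 D (meanField P g) →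
      (∀ x' ∈ D, ∀ l : Fin 2, IsCurlFreeOn2 D (covColumn P g x' l)) →
      ∀ᵐ ω ∂P, IsCurlFreeOn2 D (g ω)) ∧
    (∀ (D : Set (Vec 3)) (g : Ω → Vec 3 → Vec 3), IsCompact D →
      IsGaussianProcessOn P D g → (∀ᵐ ω ∂P, IsC1On D (g ω)) →
      IsCurlFreeOn3 D (meanField P g) →
      (∀ x' ∈ D, ∀ l : Fin 3, IsCurlFreeOn3 D (covColumn P g x' l)) →
      ∀ᵐ ω ∂P, IsCurlFreeOn3 D (g ω)) := by
  refine ⟨fun d D g _ hg hC1 hm hK => ?_, fun D g _ hg hC1 hm hK => ?_,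
    fun D g _ hg hC1 hm hK => ?_⟩
  · have hT : ∀ A, divOf A = (∑ k : Fin d, partialOfLinear k k) A := fun A => by
      simp [divOf, partialOfLinear_apply]
    simp only [IsDivFreeOn, hT] at hm hK ⊢
    exact hC1.and (ae_forall_jacobian_eq_zero hg hC1 _ hm hK)
  · have hT : ∀ A : Vec 2 →L[ℝ] Vec 2, curlOf2 A =
        (partialOfLinear 1 0 - partialOfLinear 0 1 : (Vec 2 →L[ℝ] Vec 2) →ₗ[ℝ] ℝ) A :=
       fun A => rfl
    simp only [IsCurlFreeOn2, hT] at hm hK ⊢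
    exact hC1.and (ae_forall_jacobian_eq_zero hg hC1 _ hm hK)
  · simp only [IsCurlFreeOn3, curlOf3_eq_zero_iff] at hm hK ⊢
    filter_upwards [hC1,
      ae_forall_jacobian_eq_zero hg hC1 (partialOfLinear 2 1 - partialOfLinear 1 2)
        ⟨hm.1, fun J hJ x hx => (hm.2 J hJ x hx).1⟩
        fun x' hx' l => ⟨(hK x' hx' l).1, fun J hJ x hx => ((hK x' hx' l).2 J hJ x hx).1⟩,
      ae_forall_jacobian_eq_zero hg hC1 (partialOfLinear 0 2 - partialOfLinear 2 0)
        ⟨hm.1, fun J hJ x hx => (hm.2 J hJ x hx).2.1⟩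
        fun x' hx' l => ⟨(hK x' hx' l).1, fun J hJ x hx => ((hK x' hx' l).2 J hJ x hx).2.1⟩,
      ae_forall_jacobian_eq_zero hg hC1 (partialOfLinear 1 0 - partialOfLinear 0 1)
        ⟨hm.1, fun J hJ x hx => (hm.2 J hJ x hx).2.2⟩
        fun x' hx' l => ⟨(hK x' hx' l).1, fun J hJ x hx => ((hK x' hx' l).2 J hJ x hx).2.2⟩]
      with ω h h0 h1 h2
    exact ⟨h, fun J hJ x hx => ⟨h0 J hJ x hx, h1 J hJ x hx, h2 J hJ x hx⟩⟩
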